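/- Let $\mathsf P>0$. For integers $1\le n_2\le n_1$ let $$\mathcal S^{(n_2,n_1)}(\mathsf P)=\Big\{x\in\mathbb R^{n_1}:\ \textstyle\sum_{i=1}^{n_2}x_i^2=n_2\mathsf P,\ \sum_{i=n_2+1}^{n_1}x_i^2=(n_1-n_2)\mathsf P\Big\}$$ be the composite power shell, and let $X^{n_1}$ be uniformly distributed on it; that is, $X^{n_1}=[U,V]$ is the concatenation of two independent random vectors, $U$ uniform (with respect to surface measure) on the sphere of radius $\sqrt{n_2\mathsf P}$ in $\mathbb R^{n_2}$ and $V$ uniform on the sphere of radius $\sqrt{(n_1-n_2)\mathsf P}$ in $\mathbb R^{n_1-n_2}$ (if $n_2=n_1$, the second part is empty). Let $P_{Y^{n_1}}$ be the law of $Y^{n_1}=X^{n_1}+Z^{n_1}$, where $Z^{n_1}\sim\mathcal N(\mathbf 0,I_{n_1})$ is independent of $X^{n_1}$, and let $Q_{Y^{n_1}}=\mathcal N(\mathbf 0,(1+\mathsf P)I_{n_1})$. Then there is an $N$, depending only on $\mathsf P$, such that for all $n_1\ge N$ and all $1\le n_2\le n_1$ the measure $P_{Y^{n_1}}$ is absolutely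 continuous with respect to $Q_{Y^{n_1}}$ and $$\frac{dP_{Y^{n_1}}}{dQ_{Y^{n_1}}}(y)\ \le\ \tilde{\mathsf K}:=729\cdot\frac{\pi}{8}\cdot\frac{(1+\mathsf P)^2}{1+2\mathsf P}$$ for $Q_{Y^{n_1}}$-almost every $y\in\mathbb R^{n_1}$; moreover the Radon–Nikodym derivative has a continuous nonnegative version that satisfies this bound at every $y\in\mathbb R^{n_1}$. -/

import Mathlib

open MeasureTheory ProbabilityTheory
open scoped ENNReal Topology

noncomputable section

/-- The power shell `{x ∈ ℝⁿ : ‖x‖² = n P}`. -/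
def powerShell (n : ℕ) (P : ℝ) : Set (EuclideanSpace ℝ (Fin n)) :=
  {x | ‖x‖ ^ 2 = n * P}

/-- The uniform distribution on the power shell `{x ∈ ℝⁿ : ‖x‖² = n P}`: the normalized surface
measure of the unit sphere, scaled to radius `√(n P)`. In dimension `0` the shell is the single
point `0`, and the uniform distribution is the point mass there. -/
def uniformPowerShell (n : ℕ) (P : ℝ) : Measure (EuclideanSpace ℝ (Fin n)) :=
  if n = 0 then Measure.dirac 0
  else
    Measure.map
      (fun u : Metric.sphere (0 : EuclideanSpace ℝ (Fin n)) 1 =>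
        √(n * P) • (u : EuclideanSpace ℝ (Fin n)))
      (((volume : Measure (EuclideanSpace ℝ (Fin n))).toSphere Set.univ)⁻¹ •
        (volume : Measure (EuclideanSpace ℝ (Fin n))).toSphere)

/-- The first `n₂` symbols of a word of length `n₁` (for `n₂ ≤ n₁`). -/
def firstSymbols {n₂ n₁ : ℕ} (h : n₂ ≤ n₁) (x : EuclideanSpace ℝ (Fin n₁)) :
    EuclideanSpace ℝ (Fin n₂) :=
  WithLp.toLp 2 fun i => x ⟨i, by omega⟩

/-- The last `n₁ - n₂` symbols of a word of length `n₁`. -/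
def lastSymbols (n₂ : ℕ) {n₁ : ℕ} (x : EuclideanSpace ℝ (Fin n₁)) :
    EuclideanSpace ℝ (Fin (n₁ - n₂)) :=
  WithLp.toLp 2 fun i => x ⟨n₂ + i, by omega⟩

/-- The concatenation `[u, v]`, of length `n₁`, of a word `u` of length `n₂ ≤ n₁` and a word `v` of
length `n₁ - n₂`. -/
def concatWords (n₂ n₁ : ℕ) (w : EuclideanSpace ℝ (Fin n₂) × EuclideanSpace ℝ (Fin (n₁ - n₂))) :
    EuclideanSpace ℝ (Fin n₁) :=
  WithLp.toLp 2 fun i =>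
    if h : (i : ℕ) < n₂ then w.1 ⟨i, h⟩ else w.2 ⟨i - n₂, by omega⟩

/-- The composite power shell: the words of length `n₁` whose first `n₂` symbols form a word of the
power shell of length `n₂` and whose last `n₁ - n₂` symbols form one of length `n₁ - n₂`. -/
def compositeShell {n₂ n₁ : ℕ} (h : n₂ ≤ n₁) (P : ℝ) : Set (EuclideanSpace ℝ (Fin n₁)) :=
  {x | firstSymbols h x ∈ powerShell n₂ P ∧ lastSymbols n₂ x ∈ powerShell (n₁ - n₂) P}

/-- The uniform distribution on the composite power shell (a product of two spheres): the normalized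
product of the two surface measures, i.e. the law of `[U, V]` with `U`, `V` independent and uniform
on their respective power shells. -/
def uniformCompositeShell (n₂ n₁ : ℕ) (P : ℝ) : Measure (EuclideanSpace ℝ (Fin n₁)) :=
  ((uniformPowerShell n₂ P).prod (uniformPowerShell (n₁ - n₂) P)).map (concatWords n₂ n₁)

/-- The output distribution of the additive white Gaussian noise channel `Y = X + Z` with
`X ∼ PX` and `Z ∼ N(0, I)` independent of `X`. -/
def awgnOutput {n : ℕ} (PX : Measure (EuclideanSpace ℝ (Fin n))) :
    Measure (EuclideanSpace ℝ (Fin n)) :=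
  PX.conv (stdGaussian (EuclideanSpace ℝ (Fin n)))

/-- The i.i.d. Gaussian output distribution `N(0, (1 + P) I)`. -/
def gaussianOutput (n : ℕ) (P : ℝ) : Measure (EuclideanSpace ℝ (Fin n)) :=
  multivariateGaussian 0 ((1 + P) • (1 : Matrix (Fin n) (Fin n) ℝ))

/-- The constant `729 · (π / 8) · (1 + P)² / (1 + 2 P)`. -/
def compositeConst (P : ℝ) : ℝ :=
  729 * (Real.pi / 8) * ((1 + P) ^ 2 / (1 + 2 * P))

/-! The uniform distributions are probability measures carried by their shells. -/

theorem measurable_concatWords (n₂ n₁ : ℕ) : Measurable (concatWords n₂ n₁) := by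
  unfold concatWords
  refine (WithLp.measurable_toLp 2 _).comp (measurable_pi_lambda _ fun i => ?_)
  by_cases h : (i : ℕ) < n₂ <;> simp only [h, dite_true, dite_false] <;> fun_prop

instance isProbabilityMeasure_uniformPowerShell (n : ℕ) (P : ℝ) :
    IsProbabilityMeasure (uniformPowerShell n P) := by
  unfold uniformPowerShell
  split_ifs with hn
  · infer_instance
  · have : NeZero n := ⟨hn⟩
    have : Nontrivial (EuclideanSpace ℝ (Fin n)) := by
      refine Module.nontrivial_of_finrank_pos (R := ℝ) ?_
      simpa using Nat.pos_of_ne_zero hn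
    have h0 : (volume : Measure (EuclideanSpace ℝ (Fin n))).toSphere ≠ 0 := by
      simp
    have : NeZero (volume : Measure (EuclideanSpace ℝ (Fin n))).toSphere := ⟨h0⟩
    refine Measure.isProbabilityMeasure_map (by fun_prop)

theorem ae_mem_powerShell (n : ℕ) {P : ℝ} (hP : 0 ≤ P) :
    ∀ᵐ x ∂(uniformPowerShell n P), x ∈ powerShell n P := by
  have hm : MeasurableSet (powerShell n P) :=
    (isClosed_eq (by fun_prop) continuous_const).measurableSet
  unfold uniformPowerShell
  split_ifs with hn
  · subst hn
    refine (ae_dirac_iff hm).2 ?_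
    simp
  · refine (ae_map_iff (by fun_prop) hm).2 ?_
    refine Filter.Eventually.of_forall fun u => ?_
    have hu : ‖(u : EuclideanSpace ℝ (Fin n))‖ = 1 := by simp
    simp only [norm_smul, hu, mul_one, Real.norm_eq_abs, sq_abs]
    exact Real.sq_sqrt (by positivity)

instance isProbabilityMeasure_uniformCompositeShell (n₂ n₁ : ℕ) (P : ℝ) :
    IsProbabilityMeasure (uniformCompositeShell n₂ n₁ P) :=
  Measure.isProbabilityMeasure_map (measurable_concatWords n₂ n₁).aemeasurable

theorem ae_mem_compositeShell {n₂ n₁ : ℕ} (h : n₂ ≤ n₁) {P : ℝ} (hP : 0 ≤ P) :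
    ∀ᵐ x ∂(uniformCompositeShell n₂ n₁ P), x ∈ compositeShell h P := by
  have hm : MeasurableSet (compositeShell h P) := by
    refine IsClosed.measurableSet (IsClosed.inter ?_ ?_)
    · exact isClosed_eq (by unfold firstSymbols; fun_prop) continuous_const
    · exact isClosed_eq (by unfold lastSymbols; fun_prop) continuous_const
  have hf : ∀ w, firstSymbols h (concatWords n₂ n₁ w) = w.1 := by
    intro w; ext i; simp [firstSymbols, concatWords]
  have hl : ∀ w, lastSymbols n₂ (concatWords n₂ n₁ w) = w.2 := by
    intro w; ext i; simp [lastSymbols, concatWords]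
  unfold uniformCompositeShell
  refine (ae_map_iff (measurable_concatWords n₂ n₁).aemeasurable hm).2 ?_
  have h1 := (Measure.quasiMeasurePreserving_fst (μ := uniformPowerShell n₂ P)
    (ν := uniformPowerShell (n₁ - n₂) P)).ae (ae_mem_powerShell n₂ hP)
  have h2 := (Measure.quasiMeasurePreserving_snd (μ := uniformPowerShell n₂ P)
    (ν := uniformPowerShell (n₁ - n₂) P)).ae (ae_mem_powerShell (n₁ - n₂) hP)
  filter_upwards [h1, h2] with w hw1 hw2
  exact ⟨by rw [hf]; exact hw1, by rw [hl]; exact hw2⟩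

end

/-!
The measure `awgnOutput PX` has density `awgnRatio P PX` with respect to `N(0, (1 + P) I)`, a continuous
function (`continuous_awgnRatio`, `awgnOutput_eq_withDensity`). For the composite shell this ratio is the
product of the ratios of the two shells (`awgnRatio_uniformCompositeShell`), so it suffices to bound the
ratio of a single shell by `√(compositeConst P)`; this holds in every dimension
(`awgnRatio_uniformPowerShell_le`), which is why no lower bound on the block length is needed.

For a single shell of radius `ρ = √(n P)` the ratio is
`(1 + P) ^ (n/2) exp (-n P / 2 - v ‖y‖² / 2) E exp ⟪X, y⟫` with `v = P / (1 + P)`. Instead of estimating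
the Bessel function `E exp ⟪X, y⟫`, compare it with the Gaussian integral
`∫ exp (⟪x, y⟫ - ‖x‖² / (2v)) dx = (2 π v) ^ (n/2) exp (v ‖y‖² / 2)`, whose dependence on `y` cancels
that of the prefactor. In polar coordinates this integral is the average over the directions `u` of
`∫ r ^ (n-1) exp (r ⟪u, y⟫ - r² / (2v)) dr`. On a window `|r - ρ| ≤ t` of width independent of `n` the
integrand is at least `3/4` of its value at `ρ` times `1 + b (r - ρ)`, and the affine term integrates to
zero whatever `b` is (`radial_lintegral_ge`). Hence the Gaussian integral is at least a constant times
`E exp ⟪X, y⟫` (`shell_mul_lintegral_exp_inner_le`). The resulting bound no longer depends on `y`, and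
Stirling's upper bound for `Γ(n/2)` (`Gamma_half_le`) shows that it is of order `√(5 + P)`, uniformly in
`n`; finally `4 (5 + P) ≤ compositeConst P`.
-/

noncomputable section

/-! ### A lower bound for radial integrals -/

theorem exp_sub_two_mul_sq_le_one_add {x : ℝ} (hx : -1 / 2 ≤ x) :
    Real.exp (x - 2 * x ^ 2) ≤ 1 + x := by
  have h1 : 0 < 1 + x := by linarith
  have h2 : (1 + x)⁻¹ ≤ Real.exp (-(x / (1 + x))) := by
    have h := Real.add_one_le_exp (-(x / (1 + x)))
    have e : -(x / (1 + x)) + 1 = (1 + x)⁻¹ := by field_simp; ring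
    rwa [e] at h
  have h3 : x - 2 * x ^ 2 ≤ x / (1 + x) := by
    rw [le_div_iff₀ h1]
    nlinarith [mul_nonneg (sq_nonneg x) (show 0 ≤ 1 + 2 * x by linarith)]
  calc Real.exp (x - 2 * x ^ 2) ≤ Real.exp (x / (1 + x)) := Real.exp_le_exp.2 h3
    _ ≤ 1 + x := by
      rw [Real.exp_neg] at h2
      exact (inv_le_inv₀ h1 (Real.exp_pos _)).1 h2

/-- The radial integrand `F(r) = r ^ m * exp (r c - r² / (2v))` lies above `3/4 · F(ρ) · (1 + b (r - ρ))`
on a window around `ρ`. The slope `b` of `log F` at `ρ` depends on `c`, but the affine term integrates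
to zero over the symmetric window, so that its size is irrelevant. -/
theorem pow_mul_exp_ge_affine (m : ℕ) {ρ v t c r : ℝ} (hρ : 0 < ρ) (hv : 0 < v)
    (htρ : t ≤ ρ / 2) (ht : (2 * m / ρ ^ 2 + 1 / (2 * v)) * t ^ 2 ≤ 1 / 4)
    (hr : |r - ρ| ≤ t) :
    3 / 4 * (ρ ^ m * Real.exp (ρ * c - ρ ^ 2 / (2 * v))) *
        (1 + (m / ρ + c - ρ / v) * (r - ρ)) ≤
      r ^ m * Real.exp (r * c - r ^ 2 / (2 * v)) := by
  set b := m / ρ + c - ρ / v with hb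
  obtain ⟨x, hx⟩ : ∃ x, x = (r - ρ) / ρ := ⟨_, rfl⟩
  have hrx : r = ρ * (1 + x) := by rw [hx]; field_simp; ring
  have hx2 : -1 / 2 ≤ x := by
    rw [hx, le_div_iff₀ hρ]
    have := (abs_le.1 hr).1
    linarith
  have hpow : ρ ^ m * Real.exp (m * (x - 2 * x ^ 2)) ≤ r ^ m := by
    rw [hrx, mul_pow, Real.exp_nat_mul]
    gcongr
    exact exp_sub_two_mul_sq_le_one_add hx2
  have hδ : (r - ρ) ^ 2 ≤ t ^ 2 := by
    rw [← sq_abs (r - ρ)]; gcongr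
  have hκ : (2 * m / ρ ^ 2 + 1 / (2 * v)) * (r - ρ) ^ 2 ≤ 1 / 4 :=
    le_trans (by gcongr) ht
  have hexp : m * (x - 2 * x ^ 2) + (r * c - r ^ 2 / (2 * v)) =
      (ρ * c - ρ ^ 2 / (2 * v)) +
        (b * (r - ρ) - (2 * m / ρ ^ 2 + 1 / (2 * v)) * (r - ρ) ^ 2) := by
    rw [hb, hx]; field_simp; ring
  have h34 : 3 / 4 * Real.exp (b * (r - ρ)) ≤
      Real.exp (b * (r - ρ) - (2 * m / ρ ^ 2 + 1 / (2 * v)) * (r - ρ) ^ 2) := by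
    rw [sub_eq_add_neg (b * (r - ρ)), Real.exp_add, mul_comm]
    gcongr
    have := Real.add_one_le_exp (-((2 * m / ρ ^ 2 + 1 / (2 * v)) * (r - ρ) ^ 2))
    linarith
  calc _ ≤ 3 / 4 * (ρ ^ m * Real.exp (ρ * c - ρ ^ 2 / (2 * v))) * Real.exp (b * (r - ρ)) := by
        gcongr
        have := Real.add_one_le_exp (b * (r - ρ))
        linarith
    _ = ρ ^ m * Real.exp (ρ * c - ρ ^ 2 / (2 * v)) * (3 / 4 * Real.exp (b * (r - ρ))) := by ring
    _ ≤ ρ ^ m * Real.exp (ρ * c - ρ ^ 2 / (2 * v)) *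
        Real.exp (b * (r - ρ) - (2 * m / ρ ^ 2 + 1 / (2 * v)) * (r - ρ) ^ 2) := by gcongr
    _ = ρ ^ m * Real.exp (m * (x - 2 * x ^ 2)) * Real.exp (r * c - r ^ 2 / (2 * v)) := by
        rw [mul_assoc, ← Real.exp_add, ← hexp, Real.exp_add]; ring
    _ ≤ _ := by gcongr

/-- The radial integral is at least `3/2 · t` times the value of the integrand at `ρ`, for every `c`:
no optimality of `ρ` is needed, because a linear tilt can only increase an average over the symmetric
window `[ρ - t, ρ + t]`. -/
theorem radial_lintegral_ge (m : ℕ) {ρ v t : ℝ} (hρ : 0 < ρ) (hv : 0 < v) (ht0 : 0 ≤ t)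
    (htρ : t ≤ ρ / 2) (ht : (2 * m / ρ ^ 2 + 1 / (2 * v)) * t ^ 2 ≤ 1 / 4) (c : ℝ) :
    ENNReal.ofReal (3 / 2 * t * (ρ ^ m * Real.exp (ρ * c - ρ ^ 2 / (2 * v)))) ≤
      ∫⁻ r in Set.Ioi (0 : ℝ),
        ENNReal.ofReal (r ^ m * Real.exp (r * c - r ^ 2 / (2 * v))) := by
  set F : ℝ → ℝ := fun r => r ^ m * Real.exp (r * c - r ^ 2 / (2 * v)) with hF
  have hFc : Continuous F := by fun_prop
  have hle : ρ - t ≤ ρ + t := by linarith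
  set b := m / ρ + c - ρ / v with hb
  set C := 3 / 4 * (ρ ^ m * Real.exp (ρ * c - ρ ^ 2 / (2 * v))) with hC
  have hG : ∫ r in (ρ - t)..(ρ + t), C * (1 + b * (r - ρ)) =
      3 / 2 * t * (ρ ^ m * Real.exp (ρ * c - ρ ^ 2 / (2 * v))) := by
    have hshift := intervalIntegral.integral_comp_sub_right (fun s => C * (1 + b * s))
      (a := ρ - t) (b := ρ + t) ρ
    rw [hshift, intervalIntegral.integral_const_mul, intervalIntegral.integral_add
      (by simp) (Continuous.intervalIntegrable (by fun_prop) _ _),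
      intervalIntegral.integral_const_mul, integral_id]
    simp only [intervalIntegral.integral_const, smul_eq_mul, hC]
    ring
  have hmono : ∫ r in (ρ - t)..(ρ + t), C * (1 + b * (r - ρ)) ≤
      ∫ r in (ρ - t)..(ρ + t), F r := by
    refine intervalIntegral.integral_mono_on hle
      (Continuous.intervalIntegrable (by fun_prop) _ _) (hFc.intervalIntegrable _ _) ?_
    intro r hr
    exact pow_mul_exp_ge_affine m hρ hv htρ ht (abs_le.2 ⟨by linarith [hr.1], by linarith [hr.2]⟩)
  rw [← hG]
  calc _ ≤ ENNReal.ofReal (∫ r in Set.Ioc (ρ - t) (ρ + t), F r) := by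
        rw [← intervalIntegral.integral_of_le hle]
        exact ENNReal.ofReal_le_ofReal hmono
    _ = ∫⁻ r in Set.Ioc (ρ - t) (ρ + t), ENNReal.ofReal (F r) := by
        refine ofReal_integral_eq_lintegral_ofReal (hFc.intervalIntegrable _ _).1 ?_
        filter_upwards [ae_restrict_mem measurableSet_Ioc] with r hr
        have : 0 < r := by linarith [hr.1]
        positivity
    _ ≤ _ := lintegral_mono_set fun r hr => by
        have := hr.1
        simp only [Set.mem_Ioi]; linarith

/-! ### Stirling's upper bound at half-integers -/

/-- A Stirling upper bound `Γ(x) ≤ 3 x ^ (-1/2) (x / e) ^ x` at the half-integers `x = n / 2`, by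
induction from `n` to `n + 2`. -/
theorem Gamma_half_le (n : ℕ) (hn : 1 ≤ n) :
    Real.Gamma (n / 2) * √(n / 2) ≤ 3 * (n / 2 / Real.exp 1) ^ ((n : ℝ) / 2) := by
  induction n using Nat.strong_induction_on with
  | _ n ih =>
    match n, hn with
    | 1, _ =>
      have h1 : ((1 : ℕ) : ℝ) / 2 = 1 / 2 := by norm_num
      rw [h1, Real.Gamma_one_half_eq, ← Real.sqrt_eq_rpow, ← Real.sqrt_mul (by positivity),
        show (3 : ℝ) = √9 by rw [show (9 : ℝ) = 3 ^ 2 by norm_num]; simp,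
        ← Real.sqrt_mul (by positivity)]
      refine Real.sqrt_le_sqrt ?_
      have hπe : Real.pi * Real.exp 1 ≤ 3.15 * 2.7182818286 :=
        mul_le_mul Real.pi_lt_d2.le Real.exp_one_lt_d9.le (Real.exp_pos 1).le (by norm_num)
      have e9 : 9 * (1 / 2 / Real.exp 1) = 9 / 2 / Real.exp 1 := by ring
      rw [e9, le_div_iff₀ (Real.exp_pos 1)]
      linarith
    | 2, _ =>
      norm_num
      rw [← Real.exp_neg, Real.exp_neg, ← div_eq_mul_inv, le_div_iff₀ (Real.exp_pos 1)]
      linarith [Real.exp_one_lt_d9]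
    | k + 3, _ =>
      have h := ih (k + 1) (by omega) (by omega)
      obtain ⟨x, hx⟩ : ∃ x : ℝ, x = ((k + 1 : ℕ) : ℝ) / 2 := ⟨_, rfl⟩
      have hx0 : 0 < x := by rw [hx]; positivity
      have hk : ((k + 3 : ℕ) : ℝ) / 2 = x + 1 := by rw [hx]; push_cast; ring
      rw [hk, Real.Gamma_add_one hx0.ne']
      rw [← hx] at h
      -- With `S(x) = x ^ (-1/2) (x / e) ^ x`, the step `x S(x) ≤ S(x + 1)` is equivalent to
      -- `1 ≤ (x + 1/2) log (1 + 1/x)`.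
      have hlog : 1 ≤ (x + 1 / 2) * Real.log (1 + x⁻¹) := by
        have := Real.le_log_one_add_of_nonneg (x := x⁻¹) (by positivity)
        calc (1 : ℝ) = (x + 1 / 2) * (2 * x⁻¹ / (x⁻¹ + 2)) := by field_simp; ring
          _ ≤ _ := by gcongr
      have hexp : √x * x ^ x * Real.exp 1 ≤ (x + 1) ^ x * √(x + 1) := by
        have e1 : (x + 1) = x * (1 + x⁻¹) := by field_simp
        have hp : Real.exp 1 ≤ (1 + x⁻¹) ^ (x + 1 / 2) := by
          rw [Real.rpow_def_of_pos (by positivity)]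
          exact Real.exp_le_exp.2 (by linarith)
        rw [e1, Real.mul_rpow hx0.le (by positivity), Real.sqrt_mul hx0.le]
        rw [Real.rpow_add (by positivity), ← Real.sqrt_eq_rpow] at hp
        calc _ ≤ √x * x ^ x * ((1 + x⁻¹) ^ x * √(1 + x⁻¹)) := by gcongr
          _ = _ := by ring
      have hpos := Real.sqrt_pos.2 hx0
      have hpos' : 0 < √(x + 1) := Real.sqrt_pos.2 (by positivity)
      rw [Real.div_rpow hx0.le (Real.exp_pos 1).le] at h
      rw [Real.div_rpow (by positivity) (Real.exp_pos 1).le, Real.rpow_add_one (by positivity),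
        Real.rpow_add_one (by positivity)]
      have hE : 0 < Real.exp 1 ^ x := by positivity
      have he : 0 < Real.exp 1 := Real.exp_pos 1
      have hsq : √(x + 1) * √(x + 1) = x + 1 := Real.mul_self_sqrt (by positivity)
      have hsx : √x * √x = x := Real.mul_self_sqrt hx0.le
      rw [← mul_div_assoc, le_div_iff₀ hE] at h
      rw [← mul_div_assoc, le_div_iff₀ (by positivity)]
      calc x * Real.Gamma x * √(x + 1) * (Real.exp 1 ^ x * Real.exp 1)
          = (Real.Gamma x * √x * Real.exp 1 ^ x) * (√x * Real.exp 1 * √(x + 1)) := by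
            nth_rewrite 1 [← hsx]; ring
        _ ≤ (3 * x ^ x) * (√x * Real.exp 1 * √(x + 1)) := by gcongr
        _ = 3 * (√x * x ^ x * Real.exp 1) * √(x + 1) := by ring
        _ ≤ 3 * ((x + 1) ^ x * √(x + 1)) * √(x + 1) := by gcongr
        _ = 3 * ((x + 1) ^ x * (√(x + 1) * √(x + 1))) := by ring
        _ = _ := by rw [hsq]

/-! ### Gaussian integrals and polar coordinates -/

theorem lintegral_exp_inner_sub_sq {n : ℕ} {v : ℝ} (hv : 0 < v) (y : EuclideanSpace ℝ (Fin n)) :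
    ∫⁻ x : EuclideanSpace ℝ (Fin n),
        ENNReal.ofReal (Real.exp (inner ℝ x y - ‖x‖ ^ 2 / (2 * v))) =
      ENNReal.ofReal ((2 * Real.pi * v) ^ ((n : ℝ) / 2) * Real.exp (v * ‖y‖ ^ 2 / 2)) := by
  have hb : 0 < 1 / (2 * v) := by positivity
  have hI := GaussianFourier.integral_rexp_neg_mul_sq_norm (V := EuclideanSpace ℝ (Fin n)) hb
  have hval : (Real.pi / (1 / (2 * v))) = 2 * Real.pi * v := by field_simp
  rw [finrank_euclideanSpace_fin, hval] at hI
  have hint : Integrable fun x : EuclideanSpace ℝ (Fin n) =>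
      Real.exp (-(1 / (2 * v)) * ‖x‖ ^ 2) := by
    refine Integrable.of_integral_ne_zero ?_
    rw [hI]; positivity
  -- Completing the square.
  have key : ∀ x : EuclideanSpace ℝ (Fin n), inner ℝ x y - ‖x‖ ^ 2 / (2 * v) =
      -(1 / (2 * v)) * ‖x - v • y‖ ^ 2 + v * ‖y‖ ^ 2 / 2 := by
    intro x
    rw [norm_sub_sq_real, norm_smul, inner_smul_right, mul_pow, Real.norm_eq_abs, sq_abs]
    field_simp; ring
  simp_rw [key, Real.exp_add]
  rw [← ofReal_integral_eq_lintegral_ofReal ((hint.comp_sub_right (v • y)).mul_const _)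
    (Filter.Eventually.of_forall fun x => by positivity), integral_mul_const,
    integral_sub_right_eq_self (fun x : EuclideanSpace ℝ (Fin n) =>
      Real.exp (-(1 / (2 * v)) * ‖x‖ ^ 2)) (v • y), hI]

/-- Polar coordinates for the lower Lebesgue integral. -/
theorem lintegral_eq_lintegral_toSphere {n : ℕ} (hn : n ≠ 0)
    {f : EuclideanSpace ℝ (Fin n) → ℝ≥0∞} (hf : Measurable f) :
    ∫⁻ x, f x = ∫⁻ u : Metric.sphere (0 : EuclideanSpace ℝ (Fin n)) 1,
      (∫⁻ r in Set.Ioi (0 : ℝ),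
        ENNReal.ofReal (r ^ (n - 1)) * f (r • (u : EuclideanSpace ℝ (Fin n))))
      ∂(volume : Measure (EuclideanSpace ℝ (Fin n))).toSphere := by
  have : Nontrivial (EuclideanSpace ℝ (Fin n)) := by
    refine Module.nontrivial_of_finrank_pos (R := ℝ) ?_
    simpa using Nat.pos_of_ne_zero hn
  have hmp :=
    (volume : Measure (EuclideanSpace ℝ (Fin n))).measurePreserving_homeomorphUnitSphereProd
  have hcompl : ∫⁻ x, f x = ∫⁻ x in ({0}ᶜ : Set (EuclideanSpace ℝ (Fin n))), f x := by
    rw [restrict_compl_singleton]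
  have hmeas : Measurable fun p : Metric.sphere (0 : EuclideanSpace ℝ (Fin n)) 1 × Set.Ioi (0 : ℝ) =>
      f ((p.2 : ℝ) • (p.1 : EuclideanSpace ℝ (Fin n))) := hf.comp (by fun_prop)
  rw [hcompl, ← lintegral_subtype_comap (measurableSet_singleton _).compl]
  have h1 : ∀ x : ({0}ᶜ : Set (EuclideanSpace ℝ (Fin n))), f x =
      (fun p : Metric.sphere (0 : EuclideanSpace ℝ (Fin n)) 1 × Set.Ioi (0 : ℝ) =>
        f ((p.2 : ℝ) • (p.1 : EuclideanSpace ℝ (Fin n)))) (homeomorphUnitSphereProd _ x) := by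
    intro x
    have hx : (x : EuclideanSpace ℝ (Fin n)) ≠ 0 := x.2
    simp [smul_smul, hx]
  simp_rw [h1]
  rw [hmp.lintegral_comp hmeas, lintegral_prod _ hmeas.aemeasurable, finrank_euclideanSpace_fin]
  refine lintegral_congr fun u => ?_
  rw [Measure.volumeIoiPow, lintegral_withDensity_eq_lintegral_mul _ (by fun_prop)
    (g := fun r : Set.Ioi (0 : ℝ) => f ((r : ℝ) • (u : EuclideanSpace ℝ (Fin n))))
    (hf.comp (by fun_prop))]
  rw [← lintegral_subtype_comap measurableSet_Ioi]
  rfl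

/-- The integral over the unit sphere against surface measure, in terms of the uniform distribution on
the power shell; the factor is the area `2 π ^ (n/2) / Γ(n/2)` of the sphere. -/
theorem lintegral_uniformPowerShell {n : ℕ} (hn : n ≠ 0) (P : ℝ)
    {f : EuclideanSpace ℝ (Fin n) → ℝ≥0∞} (hf : Measurable f) :
    ∫⁻ u : Metric.sphere (0 : EuclideanSpace ℝ (Fin n)) 1,
        f (√(n * P) • (u : EuclideanSpace ℝ (Fin n)))
        ∂(volume : Measure (EuclideanSpace ℝ (Fin n))).toSphere =
      ENNReal.ofReal (2 * Real.pi ^ ((n : ℝ) / 2) / Real.Gamma (n / 2)) *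
        ∫⁻ x, f x ∂(uniformPowerShell n P) := by
  have : Nonempty (Fin n) := ⟨⟨0, Nat.pos_of_ne_zero hn⟩⟩
  have : Nontrivial (EuclideanSpace ℝ (Fin n)) := by
    refine Module.nontrivial_of_finrank_pos (R := ℝ) ?_
    simpa using Nat.pos_of_ne_zero hn
  have hS : (volume : Measure (EuclideanSpace ℝ (Fin n))).toSphere Set.univ =
      ENNReal.ofReal (2 * Real.pi ^ ((n : ℝ) / 2) / Real.Gamma (n / 2)) := by
    have hn0 : (0 : ℝ) < n / 2 := by
      have : (0 : ℝ) < n := by exact_mod_cast Nat.pos_of_ne_zero hn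
      positivity
    have hG := Real.Gamma_pos_of_pos hn0
    rw [Measure.toSphere_apply_univ, EuclideanSpace.volume_ball, finrank_euclideanSpace_fin,
      Fintype.card_fin, Real.Gamma_add_one hn0.ne']
    rw [ENNReal.ofReal_one, one_pow, one_mul, ← ENNReal.ofReal_natCast,
      ← ENNReal.ofReal_mul (by positivity)]
    congr 1
    rw [Real.sqrt_eq_rpow, ← Real.rpow_natCast, ← Real.rpow_mul Real.pi_pos.le]
    field_simp
  unfold uniformPowerShell
  rw [if_neg hn, lintegral_map hf (by fun_prop), lintegral_smul_measure, smul_eq_mul, ← hS,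
    ← mul_assoc, ENNReal.mul_inv_cancel (Measure.measure_univ_ne_zero.2 (Measure.toSphere_ne_zero _))
    (measure_ne_top _ _), one_mul]

/-! ### The Laplace transform of the power shell -/

/-- The Laplace transform of the uniform distribution on the shell, bounded by that of a Gaussian: the
integral of `exp (⟪x, y⟫ - ‖x‖² / (2v))` over the whole space is at least its part near the shell,
which by `radial_lintegral_ge` is controlled, on each ray separately, by the value on the shell. -/
theorem shell_mul_lintegral_exp_inner_le {n : ℕ} (hn : n ≠ 0) {P v t : ℝ} (hP : 0 < P)
    (hv : 0 < v) (ht0 : 0 ≤ t) (htρ : t ≤ √(n * P) / 2)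
    (ht : (2 * (n - 1 : ℕ) / √(n * P) ^ 2 + 1 / (2 * v)) * t ^ 2 ≤ 1 / 4)
    (y : EuclideanSpace ℝ (Fin n)) :
    ENNReal.ofReal (3 / 2 * t * (√(n * P) ^ (n - 1) * Real.exp (-(n * P / (2 * v))))) *
      (ENNReal.ofReal (2 * Real.pi ^ ((n : ℝ) / 2) / Real.Gamma (n / 2)) *
        ∫⁻ x, ENNReal.ofReal (Real.exp (inner ℝ x y)) ∂(uniformPowerShell n P)) ≤
      ENNReal.ofReal ((2 * Real.pi * v) ^ ((n : ℝ) / 2) * Real.exp (v * ‖y‖ ^ 2 / 2)) := by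
  have hn0 : (0 : ℝ) < n := by exact_mod_cast Nat.pos_of_ne_zero hn
  have hρ : 0 < √(n * P) := Real.sqrt_pos.2 (by positivity)
  have hρ2 : √(n * P) ^ 2 = n * P := Real.sq_sqrt (by positivity)
  rw [← lintegral_uniformPowerShell hn P (by fun_prop), ← lintegral_const_mul _ (by fun_prop),
    ← lintegral_exp_inner_sub_sq hv y, lintegral_eq_lintegral_toSphere hn (by fun_prop)]
  refine lintegral_mono fun u => ?_
  have hu : ‖(u : EuclideanSpace ℝ (Fin n))‖ = 1 := by simp
  have h := radial_lintegral_ge (n - 1) hρ hv ht0 htρ ht (inner ℝ (u : EuclideanSpace ℝ (Fin n)) y)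
  simp only [inner_smul_left, RCLike.conj_to_real, norm_smul, hu, mul_one, Real.norm_eq_abs,
    sq_abs]
  calc _ = _ := by
        rw [← ENNReal.ofReal_mul (by positivity)]
        congr 1
        rw [mul_assoc (3 / 2 * t), mul_assoc (√(n * P) ^ (n - 1)), ← Real.exp_add, hρ2,
          add_comm, ← sub_eq_add_neg]
    _ ≤ _ := h
    _ = _ := by
        refine setLIntegral_congr_fun measurableSet_Ioi fun r hr => ?_
        rw [← ENNReal.ofReal_mul (pow_nonneg (le_of_lt hr) _)]

/-! ### The density ratio of a single shell -/

/-- The ratio of the density of `X + Z`, with `X` of law `PX` and `Z` standard Gaussian, to the density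
of `N(0, (1 + P) I)`. The normalizing constants of the two Gaussian densities combine to
`(1 + P) ^ (n / 2)`. -/
def awgnRatio {n : ℕ} (P : ℝ) (PX : Measure (EuclideanSpace ℝ (Fin n)))
    (y : EuclideanSpace ℝ (Fin n)) : ℝ :=
  (1 + P) ^ ((n : ℝ) / 2) * Real.exp (‖y‖ ^ 2 / (2 * (1 + P))) *
    ∫ x, Real.exp (-(‖y - x‖ ^ 2 / 2)) ∂PX

theorem compositeConst_ge {P : ℝ} (hP : 0 < P) : 4 * (5 + P) ≤ compositeConst P := by
  unfold compositeConst
  have h1 : 273 * ((1 + P) ^ 2 / (1 + 2 * P)) ≤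
      729 * (Real.pi / 8) * ((1 + P) ^ 2 / (1 + 2 * P)) := by
    gcongr; linarith [Real.pi_gt_three]
  refine le_trans ?_ h1
  rw [← mul_div_assoc, le_div_iff₀ (by positivity)]
  nlinarith

/-- Bookkeeping of the constants: after Stirling's bound all powers of `n` cancel, and there remains
`√2 √P ≤ √(compositeConst P) t`, which is `4 (5 + P) ≤ compositeConst P`. -/
theorem shell_constant_le {n : ℕ} (hn : n ≠ 0) {P v t : ℝ} (hP : 0 < P)
    (hv : v = P / (1 + P)) (ht : t = √(P / (2 * (5 + P)))) :
    (1 + P) ^ ((n : ℝ) / 2) * Real.exp (-(n * P / 2)) * (2 * Real.pi * v) ^ ((n : ℝ) / 2) ≤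
      √(compositeConst P) *
        ((3 / 2 * t * (√(n * P) ^ (n - 1) * Real.exp (-(n * P / (2 * v))))) *
          (2 * Real.pi ^ ((n : ℝ) / 2) / Real.Gamma (n / 2))) := by
  have hn0 : (0 : ℝ) < n := by exact_mod_cast Nat.pos_of_ne_zero hn
  have hρ : 0 < √(n * P) := Real.sqrt_pos.2 (by positivity)
  have hΓ : 0 < Real.Gamma (n / 2) := Real.Gamma_pos_of_pos (by positivity)
  have hB : √2 * √P ≤ √(compositeConst P) * t := by
    rw [ht, ← Real.sqrt_mul (by norm_num), ← Real.sqrt_mul' _ (by positivity)]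
    refine Real.sqrt_le_sqrt ?_
    rw [← mul_div_assoc, le_div_iff₀ (by positivity)]
    nlinarith [mul_le_mul_of_nonneg_right (compositeConst_ge hP) hP.le]
  have hv1 : n * P / (2 * v) = n * P / 2 + n / 2 := by rw [hv]; field_simp; ring
  have hpow : √(n * P) ^ (n - 1) * √(n * P) = n ^ ((n : ℝ) / 2) * P ^ ((n : ℝ) / 2) := by
    rw [← pow_succ, Nat.sub_add_cancel (Nat.pos_of_ne_zero hn), Real.sqrt_eq_rpow,
      ← Real.rpow_natCast, ← Real.rpow_mul (by positivity), ← Real.mul_rpow (by positivity) hP.le]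
    congr 1; ring
  have hL : (1 + P) ^ ((n : ℝ) / 2) * (2 * Real.pi * v) ^ ((n : ℝ) / 2) =
      2 ^ ((n : ℝ) / 2) * Real.pi ^ ((n : ℝ) / 2) * P ^ ((n : ℝ) / 2) := by
    rw [← Real.mul_rpow (by positivity) (by rw [hv]; positivity), hv,
      ← Real.mul_rpow (by positivity) (by positivity),
      ← Real.mul_rpow (by positivity) (by positivity)]
    congr 1; field_simp
  have hG := Gamma_half_le n (Nat.pos_of_ne_zero hn)
  have hE : Real.exp (n / 2) = Real.exp 1 ^ ((n : ℝ) / 2) := by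
    rw [← Real.exp_mul, one_mul]
  rw [Real.div_rpow (by positivity) (Real.exp_pos 1).le, Real.div_rpow hn0.le (by norm_num),
    ← hE, Real.sqrt_div hn0.le, div_div, ← mul_div_assoc, ← mul_div_assoc,
    div_le_div_iff₀ (by positivity) (by positivity)] at hG
  -- `Γ(n/2) √n 2^{n/2} e^{n/2} ≤ 3 √2 n^{n/2}`
  have hs : √(n * P) = √n * √P := Real.sqrt_mul hn0.le P
  have hmain : Real.Gamma (n / 2) * 2 ^ ((n : ℝ) / 2) * Real.exp (n / 2) * √(n * P) ≤
      3 * (√(compositeConst P) * t) * n ^ ((n : ℝ) / 2) := by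
    calc _ = Real.Gamma (n / 2) * √n * (2 ^ ((n : ℝ) / 2) * Real.exp (n / 2)) * √P := by
          rw [hs]; ring
      _ ≤ 3 * n ^ ((n : ℝ) / 2) * √2 * √P := by gcongr
      _ = 3 * (√2 * √P) * n ^ ((n : ℝ) / 2) := by ring
      _ ≤ _ := by gcongr
  rw [hv1, neg_add, Real.exp_add, Real.exp_neg (n / 2)]
  have hpow' : √(n * P) ^ (n - 1) = n ^ ((n : ℝ) / 2) * P ^ ((n : ℝ) / 2) / √(n * P) := by
    rw [eq_div_iff hρ.ne', hpow]
  rw [hpow']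
  have := Real.exp_pos ((n : ℝ) / 2)
  calc _ = (2 ^ ((n : ℝ) / 2) * Real.pi ^ ((n : ℝ) / 2) * P ^ ((n : ℝ) / 2)) *
        Real.exp (-(n * P / 2)) := by rw [← hL]; ring
    _ = (Real.Gamma (n / 2) * 2 ^ ((n : ℝ) / 2) * Real.exp (n / 2) * √(n * P)) *
        (Real.pi ^ ((n : ℝ) / 2) * P ^ ((n : ℝ) / 2) * Real.exp (-(n * P / 2)) /
          (Real.Gamma (n / 2) * Real.exp (n / 2) * √(n * P))) := by
        field_simp
    _ ≤ (3 * (√(compositeConst P) * t) * n ^ ((n : ℝ) / 2)) *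
        (Real.pi ^ ((n : ℝ) / 2) * P ^ ((n : ℝ) / 2) * Real.exp (-(n * P / 2)) /
          (Real.Gamma (n / 2) * Real.exp (n / 2) * √(n * P))) := by gcongr
    _ = _ := by field_simp

/-- The density ratio of a single power shell is at most `√(compositeConst P)`, in every dimension
(also `n = 0`) and at every point. -/
theorem awgnRatio_uniformPowerShell_le (n : ℕ) {P : ℝ} (hP : 0 < P)
    (y : EuclideanSpace ℝ (Fin n)) :
    awgnRatio P (uniformPowerShell n P) y ≤ √(compositeConst P) := by
  rcases eq_or_ne n 0 with rfl | hn
  · have h1 : 1 ≤ √(compositeConst P) := by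
      rw [Real.one_le_sqrt]; linarith [compositeConst_ge hP]
    have hy : y = 0 := Subsingleton.elim _ _
    simpa [awgnRatio, uniformPowerShell, hy] using h1
  have hn0 : (1 : ℝ) ≤ n := by exact_mod_cast Nat.pos_of_ne_zero hn
  have hΓ : 0 < Real.Gamma (n / 2) := Real.Gamma_pos_of_pos (by positivity)
  obtain ⟨v, hv⟩ : ∃ v, v = P / (1 + P) := ⟨_, rfl⟩
  -- With `v = P / (1 + P)` the factor `exp (v ‖y‖² / 2)` of the Gaussian Laplace transform cancels the
  -- other factors that depend on `y`. The window `t` makes `(2 / P + 1 / (2v)) t² = 1/4`, which bounds the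
  -- second-order loss in every dimension.
  obtain ⟨t, ht⟩ : ∃ t, t = √(P / (2 * (5 + P))) := ⟨_, rfl⟩
  have hv0 : 0 < v := by rw [hv]; positivity
  have ht0 : 0 < t := by rw [ht]; exact Real.sqrt_pos.2 (by positivity)
  have hρ : 0 < √(n * P) := Real.sqrt_pos.2 (by positivity)
  have htρ : t ≤ √(n * P) / 2 := by
    rw [ht, show (2 : ℝ) = √4 by rw [show (4 : ℝ) = 2 ^ 2 by norm_num]; simp,
      ← Real.sqrt_div (by positivity)]
    refine Real.sqrt_le_sqrt ?_
    rw [show √(4 : ℝ) = 2 by rw [show (4 : ℝ) = 2 ^ 2 by norm_num]; simp,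
      div_le_div_iff₀ (by positivity) (by norm_num)]
    nlinarith [mul_nonneg (sub_nonneg.2 hn0) hP.le, mul_pos hP hP,
      mul_nonneg (mul_nonneg (sub_nonneg.2 hn0) hP.le) hP.le]
  have hκ : (2 * (n - 1 : ℕ) / √(n * P) ^ 2 + 1 / (2 * v)) * t ^ 2 ≤ 1 / 4 := by
    have h2 : 2 * ((n - 1 : ℕ) : ℝ) / √(n * P) ^ 2 ≤ 2 / P := by
      rw [Real.sq_sqrt (by positivity), div_le_div_iff₀ (by positivity) hP]
      have : ((n - 1 : ℕ) : ℝ) ≤ n := by exact_mod_cast Nat.sub_le n 1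
      nlinarith
    calc _ ≤ (2 / P + 1 / (2 * v)) * t ^ 2 := by gcongr
      _ = 1 / 4 := by
        rw [ht, Real.sq_sqrt (by positivity), hv]; field_simp; ring
  have hmain := shell_mul_lintegral_exp_inner_le hn hP hv0 ht0.le htρ hκ y
  have hconst := shell_constant_le hn hP hv ht
  obtain ⟨D, hD⟩ : ∃ D, D = (3 / 2 * t * (√(n * P) ^ (n - 1) * Real.exp (-(n * P / (2 * v))))) *
      (2 * Real.pi ^ ((n : ℝ) / 2) / Real.Gamma (n / 2)) := ⟨_, rfl⟩
  have hD0 : 0 < D := by rw [hD]; positivity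
  rw [← mul_assoc, ← ENNReal.ofReal_mul (by positivity), ← hD] at hmain
  rw [← hD] at hconst
  have hlin : ∫⁻ x, ENNReal.ofReal (Real.exp (inner ℝ x y)) ∂(uniformPowerShell n P) ≤
      ENNReal.ofReal ((2 * Real.pi * v) ^ ((n : ℝ) / 2) * Real.exp (v * ‖y‖ ^ 2 / 2) / D) := by
    rw [ENNReal.ofReal_div_of_pos hD0, ENNReal.le_div_iff_mul_le (by simp [hD0]) (by simp),
      mul_comm]
    exact hmain
  have hint : ∫ x, Real.exp (-(‖y - x‖ ^ 2 / 2)) ∂(uniformPowerShell n P) ≤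
      Real.exp (-(‖y‖ ^ 2 / 2) - n * P / 2) *
        ((2 * Real.pi * v) ^ ((n : ℝ) / 2) * Real.exp (v * ‖y‖ ^ 2 / 2) / D) := by
    rw [integral_eq_lintegral_of_nonneg_ae (Filter.Eventually.of_forall fun x => by positivity)
      (by fun_prop)]
    refine ENNReal.toReal_le_of_le_ofReal (by positivity) ?_
    rw [ENNReal.ofReal_mul (by positivity)]
    refine le_trans (le_of_eq ?_) (mul_le_mul_right hlin _)
    rw [← lintegral_const_mul _ (by fun_prop)]
    refine lintegral_congr_ae ?_
    -- On the shell `‖x‖² = n P`, so the Gaussian kernel is a constant multiple of `exp ⟪x, y⟫`.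
    filter_upwards [ae_mem_powerShell n hP.le] with x hx
    rw [← ENNReal.ofReal_mul (by positivity), ← Real.exp_add]
    have hx' : ‖x‖ ^ 2 = n * P := hx
    rw [norm_sub_sq_real, hx', real_inner_comm]
    congr 2; ring
  have hexp : Real.exp (‖y‖ ^ 2 / (2 * (1 + P))) * Real.exp (-(‖y‖ ^ 2 / 2) - n * P / 2) *
      Real.exp (v * ‖y‖ ^ 2 / 2) = Real.exp (-(n * P / 2)) := by
    rw [← Real.exp_add, ← Real.exp_add, hv]
    congr 1; field_simp; ring
  unfold awgnRatio
  calc _ ≤ (1 + P) ^ ((n : ℝ) / 2) * Real.exp (‖y‖ ^ 2 / (2 * (1 + P))) *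
        (Real.exp (-(‖y‖ ^ 2 / 2) - n * P / 2) *
        ((2 * Real.pi * v) ^ ((n : ℝ) / 2) * Real.exp (v * ‖y‖ ^ 2 / 2) / D)) := by gcongr
    _ = (1 + P) ^ ((n : ℝ) / 2) * Real.exp (-(n * P / 2)) *
        (2 * Real.pi * v) ^ ((n : ℝ) / 2) / D := by rw [← hexp]; ring
    _ ≤ _ := by rwa [div_le_iff₀ hD0]

/-! ### Output densities of the Gaussian channel -/

/-- The Lebesgue density of `N(0, v I)`, identified by its characteristic function. -/
theorem multivariateGaussian_smul_one_eq_withDensity (n : ℕ) {v : ℝ} (hv : 0 < v) :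
    multivariateGaussian 0 (v • (1 : Matrix (Fin n) (Fin n) ℝ)) =
      (volume : Measure (EuclideanSpace ℝ (Fin n))).withDensity fun x =>
        ENNReal.ofReal (((2 * Real.pi * v) ^ ((n : ℝ) / 2))⁻¹ *
          Real.exp (-(‖x‖ ^ 2 / (2 * v)))) := by
  have hA : 0 < (2 * Real.pi * v) ^ ((n : ℝ) / 2) := by positivity
  have hlin := lintegral_exp_inner_sub_sq hv (0 : EuclideanSpace ℝ (Fin n))
  have hfin : IsFiniteMeasure ((volume : Measure (EuclideanSpace ℝ (Fin n))).withDensity fun x =>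
      ENNReal.ofReal (((2 * Real.pi * v) ^ ((n : ℝ) / 2))⁻¹ *
        Real.exp (-(‖x‖ ^ 2 / (2 * v))))) := by
    refine isFiniteMeasure_withDensity ?_
    simp only [ENNReal.ofReal_mul (inv_nonneg.2 hA.le)]
    rw [lintegral_const_mul _ (by fun_prop)]
    refine ENNReal.mul_ne_top ENNReal.ofReal_ne_top ?_
    simp only [inner_zero_right, zero_sub] at hlin
    rw [hlin]
    exact ENNReal.ofReal_ne_top
  refine Measure.ext_of_charFun ?_
  ext s
  have hS : (v • (1 : Matrix (Fin n) (Fin n) ℝ)).PosSemidef := Matrix.PosSemidef.one.smul hv.le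
  rw [charFun_multivariateGaussian hS, charFun_apply,
    integral_withDensity_eq_integral_toReal_smul (by fun_prop)
      (Filter.Eventually.of_forall fun x => ENNReal.ofReal_lt_top)]
  have hb : 0 < (((1 / (2 * v) : ℝ) : ℂ)).re := by rw [Complex.ofReal_re]; positivity
  have hF := GaussianFourier.integral_cexp_neg_mul_sq_norm_add hb Complex.I s
  have hcongr : ∀ x : EuclideanSpace ℝ (Fin n),
      (ENNReal.ofReal (((2 * Real.pi * v) ^ ((n : ℝ) / 2))⁻¹ *
        Real.exp (-(‖x‖ ^ 2 / (2 * v))))).toReal • Complex.exp (inner ℝ x s * Complex.I) =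
      ((((2 * Real.pi * v) ^ ((n : ℝ) / 2))⁻¹ : ℝ) : ℂ) *
        Complex.exp (-((1 / (2 * v) : ℝ) : ℂ) * (‖x‖ : ℂ) ^ 2 + Complex.I * (inner ℝ s x : ℝ)) := by
    intro x
    rw [ENNReal.toReal_ofReal (by positivity), Complex.real_smul, Complex.ofReal_mul,
      Complex.ofReal_exp, mul_assoc, ← Complex.exp_add, real_inner_comm]
    congr 2
    push_cast; ring
  simp_rw [hcongr]
  rw [integral_const_mul, hF, finrank_euclideanSpace_fin]
  have hbase : (Real.pi / ((1 / (2 * v) : ℝ) : ℂ)) ^ ((n : ℂ) / 2) =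
      (((2 * Real.pi * v) ^ ((n : ℝ) / 2) : ℝ) : ℂ) := by
    rw [Complex.ofReal_cpow (by positivity)]
    congr 1
    · push_cast; field_simp
    · push_cast; rfl
  rw [hbase, ← mul_assoc, ← Complex.ofReal_mul, inv_mul_cancel₀ hA.ne', Complex.ofReal_one, one_mul]
  congr 1
  have hquad : s.ofLp ⬝ᵥ (v • (1 : Matrix (Fin n) (Fin n) ℝ)).mulVec s.ofLp = v * ‖s‖ ^ 2 := by
    rw [Matrix.smul_mulVec, Matrix.one_mulVec, dotProduct_smul, smul_eq_mul,
      EuclideanSpace.real_norm_sq_eq, dotProduct]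
    simp only [sq]
  rw [Complex.I_sq, hquad, inner_zero_right]
  push_cast
  field_simp
  ring

theorem conv_withDensity_eq {n : ℕ} (μ : Measure (EuclideanSpace ℝ (Fin n))) [IsFiniteMeasure μ]
    {g : EuclideanSpace ℝ (Fin n) → ℝ≥0∞} (hg : Measurable g)
    [SFinite ((volume : Measure (EuclideanSpace ℝ (Fin n))).withDensity g)] :
    μ.conv (volume.withDensity g) =
      (volume : Measure (EuclideanSpace ℝ (Fin n))).withDensity fun y => ∫⁻ x, g (y - x) ∂μ := by
  refine Measure.ext_of_lintegral _ fun f hf => ?_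
  have hmeas : Measurable fun p : EuclideanSpace ℝ (Fin n) × EuclideanSpace ℝ (Fin n) =>
      g (p.2 - p.1) := by fun_prop
  rw [Measure.lintegral_conv hf,
    lintegral_withDensity_eq_lintegral_mul _ hmeas.lintegral_prod_left' hf]
  have h1 : ∀ x : EuclideanSpace ℝ (Fin n), ∫⁻ z, f (x + z) ∂(volume.withDensity g) =
      ∫⁻ y, g (y - x) * f y := by
    intro x
    rw [lintegral_withDensity_eq_lintegral_mul _ hg (by fun_prop),
      ← lintegral_sub_right_eq_self _ x]
    simp
  simp_rw [h1]
  rw [lintegral_lintegral_swap (by fun_prop)]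
  refine lintegral_congr fun y => ?_
  rw [lintegral_mul_const _ (by fun_prop)]
  rfl

theorem integrable_exp_neg_sq {n : ℕ} (PX : Measure (EuclideanSpace ℝ (Fin n)))
    [IsFiniteMeasure PX] (y : EuclideanSpace ℝ (Fin n)) :
    Integrable (fun x => Real.exp (-(‖y - x‖ ^ 2 / 2))) PX := by
  refine Integrable.of_bound (by fun_prop) 1 (Filter.Eventually.of_forall fun x => ?_)
  rw [Real.norm_eq_abs, Real.abs_exp, Real.exp_le_one_iff]
  have : 0 ≤ ‖y - x‖ ^ 2 / 2 := by positivity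
  linarith

theorem continuous_awgnRatio {n : ℕ} (P : ℝ) (PX : Measure (EuclideanSpace ℝ (Fin n)))
    [IsFiniteMeasure PX] : Continuous (awgnRatio P PX) := by
  unfold awgnRatio
  refine Continuous.mul (by fun_prop) ?_
  refine continuous_of_dominated (bound := fun _ => 1) (fun y => by fun_prop) (fun y => ?_)
    (integrable_const _) (Filter.Eventually.of_forall fun x => by fun_prop)
  refine Filter.Eventually.of_forall fun x => ?_
  rw [Real.norm_eq_abs, Real.abs_exp, Real.exp_le_one_iff]
  have : 0 ≤ ‖y - x‖ ^ 2 / 2 := by positivity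
  linarith

theorem awgnRatio_nonneg {n : ℕ} {P : ℝ} (hP : 0 < P) (PX : Measure (EuclideanSpace ℝ (Fin n)))
    (y : EuclideanSpace ℝ (Fin n)) : 0 ≤ awgnRatio P PX y :=
  mul_nonneg (by positivity) (integral_nonneg fun x => by positivity)

theorem awgnOutput_eq_withDensity {n : ℕ} {P : ℝ} (hP : 0 < P)
    (PX : Measure (EuclideanSpace ℝ (Fin n))) [IsFiniteMeasure PX] :
    awgnOutput PX =
      (gaussianOutput n P).withDensity fun y => ENNReal.ofReal (awgnRatio P PX y) := by
  have hstd : stdGaussian (EuclideanSpace ℝ (Fin n)) =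
      (volume : Measure (EuclideanSpace ℝ (Fin n))).withDensity fun x =>
        ENNReal.ofReal (((2 * Real.pi * 1) ^ ((n : ℝ) / 2))⁻¹ *
          Real.exp (-(‖x‖ ^ 2 / (2 * 1)))) := by
    rw [← multivariateGaussian_smul_one_eq_withDensity n one_pos, one_smul,
      multivariateGaussian_zero_one]
  unfold awgnOutput gaussianOutput
  rw [multivariateGaussian_smul_one_eq_withDensity n (by linarith : 0 < 1 + P), hstd,
    conv_withDensity_eq PX (by fun_prop),
    ← withDensity_mul _ (by fun_prop) (continuous_awgnRatio P PX).measurable.ennreal_ofReal]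
  congr 1
  ext y
  rw [Pi.mul_apply, ← ENNReal.ofReal_mul (by positivity),
    ← ofReal_integral_eq_lintegral_ofReal ?_ (Filter.Eventually.of_forall fun x => by positivity)]
  · congr 1
    simp only [mul_one]
    rw [integral_const_mul, awgnRatio,
      Real.mul_rpow (by positivity : 0 ≤ 2 * Real.pi) (by positivity : 0 ≤ 1 + P), Real.exp_neg]
    field_simp
  · simpa using (integrable_exp_neg_sq PX y).const_mul _

/-! ### The composite shell -/

theorem norm_sq_eq_firstSymbols_add_lastSymbols {n₂ n₁ : ℕ} (h : n₂ ≤ n₁)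
    (y : EuclideanSpace ℝ (Fin n₁)) :
    ‖y‖ ^ 2 = ‖firstSymbols h y‖ ^ 2 + ‖lastSymbols n₂ y‖ ^ 2 := by
  have e : n₂ + (n₁ - n₂) = n₁ := by omega
  simp only [EuclideanSpace.real_norm_sq_eq]
  rw [← (finCongr e).sum_comp, Fin.sum_univ_add]
  rfl

theorem norm_sub_concatWords_sq {n₂ n₁ : ℕ} (h : n₂ ≤ n₁) (y : EuclideanSpace ℝ (Fin n₁))
    (w : EuclideanSpace ℝ (Fin n₂) × EuclideanSpace ℝ (Fin (n₁ - n₂))) :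
    ‖y - concatWords n₂ n₁ w‖ ^ 2 =
      ‖firstSymbols h y - w.1‖ ^ 2 + ‖lastSymbols n₂ y - w.2‖ ^ 2 := by
  have h1 : firstSymbols h (y - concatWords n₂ n₁ w) = firstSymbols h y - w.1 := by
    ext i; simp [firstSymbols, concatWords]
  have h2 : lastSymbols n₂ (y - concatWords n₂ n₁ w) = lastSymbols n₂ y - w.2 := by
    ext i; simp [lastSymbols, concatWords]
  rw [norm_sq_eq_firstSymbols_add_lastSymbols h, h1, h2]

/-- The ratio of the composite shell is the product of the ratios of its two shells, since the kernel
`exp (-‖y - x‖² / 2)` and the measure are both products. -/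
theorem awgnRatio_uniformCompositeShell {n₂ n₁ : ℕ} (h : n₂ ≤ n₁) {P : ℝ} (hP : 0 < P)
    (y : EuclideanSpace ℝ (Fin n₁)) :
    awgnRatio P (uniformCompositeShell n₂ n₁ P) y =
      awgnRatio P (uniformPowerShell n₂ P) (firstSymbols h y) *
        awgnRatio P (uniformPowerShell (n₁ - n₂) P) (lastSymbols n₂ y) := by
  have hdim : ((n₁ : ℝ)) / 2 = (n₂ : ℝ) / 2 + ((n₁ - n₂ : ℕ) : ℝ) / 2 := by
    rw [Nat.cast_sub h]; ring
  unfold awgnRatio uniformCompositeShell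
  rw [integral_map (measurable_concatWords n₂ n₁).aemeasurable (by fun_prop)]
  simp_rw [norm_sub_concatWords_sq h, add_div, neg_add, Real.exp_add]
  rw [integral_prod_mul (fun x => Real.exp (-(‖firstSymbols h y - x‖ ^ 2 / 2)))
    (fun x => Real.exp (-(‖lastSymbols n₂ y - x‖ ^ 2 / 2))),
    norm_sq_eq_firstSymbols_add_lastSymbols h y, hdim,
    Real.rpow_add (by linarith), add_div, Real.exp_add]
  ring

theorem mainTheorem5 (P : ℝ) (hP : 0 < P) :
    ∃ N : ℕ, ∀ n₁ n₂ : ℕ, N ≤ n₁ → 1 ≤ n₂ → n₂ ≤ n₁ →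
      awgnOutput (uniformCompositeShell n₂ n₁ P) ≪ gaussianOutput n₁ P ∧
      (∀ᵐ y ∂(gaussianOutput n₁ P),
        (awgnOutput (uniformCompositeShell n₂ n₁ P)).rnDeriv (gaussianOutput n₁ P) y
          ≤ ENNReal.ofReal (compositeConst P)) ∧
      ∃ f : EuclideanSpace ℝ (Fin n₁) → ℝ, Continuous f ∧
        awgnOutput (uniformCompositeShell n₂ n₁ P)
          = (gaussianOutput n₁ P).withDensity (fun y => ENNReal.ofReal (f y)) ∧
        ∀ y, 0 ≤ f y ∧ f y ≤ compositeConst P := by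
  -- The bound on a single shell holds in every dimension, so no threshold is needed.
  refine ⟨0, fun n₁ n₂ _ _ h => ?_⟩
  have hcont := continuous_awgnRatio P (uniformCompositeShell n₂ n₁ P)
  have hdens := awgnOutput_eq_withDensity hP (uniformCompositeShell n₂ n₁ P)
  have hbound : ∀ y, awgnRatio P (uniformCompositeShell n₂ n₁ P) y ≤ compositeConst P := by
    intro y
    rw [awgnRatio_uniformCompositeShell h hP]
    calc _ ≤ √(compositeConst P) * √(compositeConst P) :=
          mul_le_mul (awgnRatio_uniformPowerShell_le _ hP _)
            (awgnRatio_uniformPowerShell_le _ hP _) (awgnRatio_nonneg hP _ _) (Real.sqrt_nonneg _)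
      _ = _ := Real.mul_self_sqrt (by linarith [compositeConst_ge hP])
  have : IsProbabilityMeasure (gaussianOutput n₁ P) := by unfold gaussianOutput; infer_instance
  refine ⟨?_, ?_, _, hcont, hdens, fun y => ⟨awgnRatio_nonneg hP _ y, hbound y⟩⟩
  · rw [hdens]; exact withDensity_absolutelyContinuous _ _
  · rw [hdens]
    filter_upwards [Measure.rnDeriv_withDensity (gaussianOutput n₁ P)
      hcont.measurable.ennreal_ofReal] with y hy
    rw [hy]
    exact ENNReal.ofReal_le_ofReal (hbound y)

end
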